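/- For a finite group $G$ with identity element $1$ and a subset $S\subseteq G$ with $S=S^{-1}$ and $1\notin S$, let $\mathrm{Cay}(G,S)$ be the graph with vertex set $G$ and edge set $\{\{g,sg\}: g\in G,\ s\in S\}$. A finite graph is called integral if all eigenvalues of its adjacency matrix are integers. Let $\mathcal{G}_3$ be the class of all finite groups $G$ such that $\mathrm{Cay}(G,S)$ is integral for every $S\subseteq G$ with $S=S^{-1}$, $1\notin S$ and $|S|\le 3$. Let $G$ be a finite nilpotent group. Then $G\in\mathcal{G}_3$ if and only if one of the following holds: (1) $G$ is a $3$-group of exponent $3$; (2) $G\cong \mathbb{Z}_2^n$ for some integer $n\ge 0$ (for $n=0$ this is the trivial group); (3) $G$ is a $2$-group of exponent $4$, and every involution of $G$ belongs to the center $Z(G)$; (4) $G\cong \mathbb{Z}_2^n\times B$ for some integer $n\ge 1$ and some $3$-group $B$ of exponent $3$. Here $\mathbb{Z}_2$ is the cyclic group of order $2$, and the exponent of a finite group is the least common multiple of the orders of its elements. -/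

import Mathlib

universe u

/-- A finite graph is integral if all eigenvalues of its adjacency matrix are integers. -/
def IsIntegralGraph {V : Type*} [Fintype V] (Γ : SimpleGraph V) : Prop :=
  open Classical in
  ∀ μ : ℂ, Module.End.HasEigenvalue (Matrix.toLin' (Γ.adjMatrix ℂ)) μ → ∃ z : ℤ, μ = (z : ℂ)

/-- The Cayley graph `Cay(G, S)`: vertex set `G`, edges `{g, s g}` with `g ∈ G` and `s ∈ S`.
It is used for symmetric `S` with `1 ∉ S`. -/
def cayleyGraph {G : Type*} [Group G] (S : Set G) : SimpleGraph G :=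
  SimpleGraph.fromRel (fun g h => ∃ s ∈ S, h = s * g)

/-- `IsInClassG k G` says that the finite group `G` belongs to the class `𝒢ₖ`: the Cayley graph
`Cay(G, S)` is integral for every symmetric subset `S` of `G` with `1 ∉ S` and `|S| ≤ k`. -/
def IsInClassG (k : ℕ) (G : Type*) [Group G] [Fintype G] : Prop :=
  ∀ S : Finset G, (∀ s ∈ S, s⁻¹ ∈ S) → (1 : G) ∉ S → S.card ≤ k →
    IsIntegralGraph (cayleyGraph (S : Set G))

/-- The elementary abelian group `ℤ₂ⁿ`, written multiplicatively. -/
abbrev ElemAbTwo (n : ℕ) : Type := Fin n → Multiplicative (ZMod 2)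

/-- A `3`-group of exponent (exactly) `3`. -/
def IsThreeGroupOfExponentThree (B : Type*) [Group B] : Prop :=
  IsPGroup 3 B ∧ Monoid.exponent B = 3

/-!
For a finite group `G`, the adjacency operator of `Cay(G, S)` on `G → ℂ` is the sum over `S` of
the left regular representation (`isIntegralGraph_cayleyGraph_iff`), so integrality is a question
about the eigenvalues of that sum.

All groups on the right-hand side satisfy `x ^ 4 = 1` or `x ^ 6 = 1` for every `x`, and have only
central involutions. This already implies integrality
(`isInClassG_three_of_pow_eq_one`): a symmetric set with at most three elements consists of
involutions and at most one pair `{s, s⁻¹}`, so its translations commute. On a common eigenvector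
every involution acts as `±1`, and the pair contributes `c + c⁻¹` for a fourth or sixth root of
unity `c`, which is an integer.

Conversely, `Cay(G, {x, x⁻¹})` has the eigenvalue `2 cos (2π / n)`, where `n` is the order of `x`,
and Niven's theorem leaves only `n ∈ {1, 2, 3, 4, 6}`. Since a nilpotent group is the product of
its Sylow subgroups, either `x ^ 4 = 1` for all `x`, or there is an element of order `3`. In the
latter case elements of order `4` are excluded, since they would give elements of order `12`, and
`G` is the product of an elementary abelian `2`-group and a `3`-group of exponent `3`. In the
former case, two involutions that do not commute generate a dihedral group of order `8`, which
yields the eigenvalue `√2`; once all involutions commute, an involution that does not commute with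
an element of order `4` yields the eigenvalue `√5`; so the involutions are central. These two eigenvalues are detected
through vectors `v ≠ 0` on which the square of the adjacency operator `A` acts as `2` or `5`: one
of `A v + √c v` and `v` is then an eigenvector.
-/

/-! ### The adjacency operator of a Cayley graph -/

/-- The left regular representation of `G` on the functions `G → ℂ`:
`(translation s f) g = f (s⁻¹ * g)`. -/
def translation (G : Type*) [Group G] : G →* Module.End ℂ (G → ℂ) where
  toFun s := LinearMap.funLeft ℂ ℂ (fun g => s⁻¹ * g)
  map_one' := by ext; simp [LinearMap.funLeft_apply]
  map_mul' s t := by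
    refine LinearMap.ext fun f => funext fun g => ?_
    simp [LinearMap.funLeft_apply, mul_assoc]

section Translation

variable {G : Type*} [Group G]

@[simp]
lemma translation_apply (s : G) (f : G → ℂ) (g : G) : translation G s f g = f (s⁻¹ * g) := rfl

lemma translation_translation (s t : G) (f : G → ℂ) :
    translation G s (translation G t f) = translation G (s * t) f := by
  rw [map_mul]; rfl

lemma translation_one (f : G → ℂ) : translation G 1 f = f := by
  rw [map_one]; rfl

lemma translation_single [DecidableEq G] (s g : G) :
    translation G s (Pi.single g 1) = Pi.single (s * g) 1 := by
  ext h
  simp [Pi.single_apply, inv_mul_eq_iff_eq_mul]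

lemma cayleyGraph_adj_iff {S : Set G} (hS : ∀ s ∈ S, s⁻¹ ∈ S) (h1 : (1 : G) ∉ S) (g h : G) :
    (cayleyGraph S).Adj g h ↔ g * h⁻¹ ∈ S := by
  have hinv : g * h⁻¹ ∈ S ↔ h * g⁻¹ ∈ S :=
    ⟨fun H => by simpa using hS _ H, fun H => by simpa using hS _ H⟩
  have key (a b : G) : (∃ s ∈ S, b = s * a) ↔ b * a⁻¹ ∈ S :=
    ⟨fun ⟨s, hs, e⟩ => by simpa [e] using hs, fun H => ⟨_, H, by simp⟩⟩
  rw [cayleyGraph, SimpleGraph.fromRel_adj, key, key, ← hinv, or_self, and_iff_right_iff_imp]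
  rintro H rfl
  exact h1 (by simpa using H)

/-- The adjacency operator of `Cay(G, S)` is the sum over `S` of the left regular
representation. -/
lemma isIntegralGraph_cayleyGraph_iff [Fintype G] {S : Finset G} (hS : ∀ s ∈ S, s⁻¹ ∈ S)
    (h1 : (1 : G) ∉ S) :
    IsIntegralGraph (cayleyGraph (S : Set G)) ↔
      ∀ μ : ℂ, (∑ s ∈ S, translation G s).HasEigenvalue μ → ∃ z : ℤ, μ = z := by
  classical
  unfold IsIntegralGraph
  suffices h : Matrix.toLin' ((cayleyGraph (S : Set G)).adjMatrix ℂ) =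
      ∑ s ∈ S, translation G s by
    rw [← h]
  refine LinearMap.ext fun f => funext fun g => ?_
  simp only [Matrix.toLin'_apply, SimpleGraph.adjMatrix_mulVec_apply, LinearMap.sum_apply,
    Finset.sum_apply, translation_apply]
  refine Finset.sum_bij' (fun h _ => g * h⁻¹) (fun s _ => s⁻¹ * g) ?_ ?_ ?_ ?_ ?_
  · intro h hh
    simpa [cayleyGraph_adj_iff (S := (S : Set G)) hS h1] using hh
  · intro s hs
    simpa [cayleyGraph_adj_iff (S := (S : Set G)) hS h1] using hs
  all_goals simp

end Translation

/-! ### Groups whose small Cayley graphs are integral -/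

/-- Commuting operators on a finite-dimensional complex space have a common eigenvector in every
nonzero subspace that they all preserve. -/
lemma exists_common_eigenvector {V ι : Type*} [AddCommGroup V] [Module ℂ V]
    [FiniteDimensional ℂ V] (T : ι → Module.End ℂ V) (s : Finset ι) (W : Submodule ℂ V)
    (hW : W ≠ ⊥) (hinv : ∀ i ∈ s, ∀ w ∈ W, T i w ∈ W)
    (hcomm : ∀ i ∈ s, ∀ j ∈ s, Commute (T i) (T j)) :
    ∃ v ∈ W, v ≠ 0 ∧ ∀ i ∈ s, ∃ c : ℂ, T i v = c • v := by
  classical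
  induction s using Finset.induction_on generalizing W with
  | empty =>
    obtain ⟨v, hv, hv0⟩ := W.ne_bot_iff.1 hW
    exact ⟨v, hv, hv0, by simp⟩
  | insert i s _ ih =>
    have : Nontrivial W := Submodule.nontrivial_iff_ne_bot.2 hW
    obtain ⟨c, hc⟩ := Module.End.exists_eigenvalue
      ((T i).restrict (hinv i (Finset.mem_insert_self i s)))
    obtain ⟨w, hw⟩ := hc.exists_hasEigenvector
    have hw' : T i (w : V) = c • (w : V) := congrArg Subtype.val hw.apply_eq_smul
    obtain ⟨v, hv, hv0, hvs⟩ := ih (W ⊓ (T i).eigenspace c)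
      ((Submodule.ne_bot_iff _).2 ⟨w, ⟨w.2, Module.End.mem_eigenspace_iff.2 hw'⟩,
        fun h => hw.2 (Subtype.ext h)⟩)
      (fun j hj v hv => ⟨hinv j (Finset.mem_insert_of_mem hj) v hv.1, by
        have hv2 := Module.End.mem_eigenspace_iff.1 hv.2
        have hij : T i (T j v) = T j (T i v) := LinearMap.congr_fun
          (hcomm i (Finset.mem_insert_self i s) j (Finset.mem_insert_of_mem hj)).eq v
        exact Module.End.mem_eigenspace_iff.2 (by rw [hij, hv2, map_smul])⟩)
      (fun j hj k hk => hcomm j (Finset.mem_insert_of_mem hj) k (Finset.mem_insert_of_mem hk))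
    refine ⟨v, hv.1, hv0, fun j hj => ?_⟩
    rcases Finset.mem_insert.1 hj with rfl | hj
    · exact ⟨c, Module.End.mem_eigenspace_iff.1 hv.2⟩
    · exact hvs j hj

lemma exists_int_eq_add_of_mul_eq_one {c d : ℂ} (hcd : c * d = 1) (hc : c ^ 4 = 1 ∨ c ^ 6 = 1) :
    ∃ z : ℤ, c + d = z := by
  have hc0 : c ≠ 0 := left_ne_zero_of_mul_eq_one hcd
  have key (z : ℤ) (h : c ^ 2 + 1 = z * c) : ∃ z : ℤ, c + d = z :=
    ⟨z, mul_left_cancel₀ hc0 (by linear_combination h + hcd)⟩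
  rcases hc with hc | hc
  · have : (c - 1) * ((c + 1) * (c ^ 2 + 1)) = 0 := by linear_combination hc
    rcases mul_eq_zero.1 this with h | h
    · exact key 2 (by push_cast; linear_combination (c - 1) * h)
    rcases mul_eq_zero.1 h with h | h
    · exact key (-2) (by push_cast; linear_combination (c + 1) * h)
    · exact key 0 (by push_cast; linear_combination h)
  · have : (c - 1) * ((c + 1) * ((c ^ 2 + c + 1) * (c ^ 2 - c + 1))) = 0 := by
      linear_combination hc
    rcases mul_eq_zero.1 this with h | h
    · exact key 2 (by push_cast; linear_combination (c - 1) * h)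
    rcases mul_eq_zero.1 h with h | h
    · exact key (-2) (by push_cast; linear_combination (c + 1) * h)
    rcases mul_eq_zero.1 h with h | h
    · exact key (-1) (by push_cast; linear_combination h)
    · exact key 1 (by push_cast; linear_combination h)

lemma ne_inv_of_mul_self_ne_one {G : Type*} [Group G] {x : G} (hx : x * x ≠ 1) : x ≠ x⁻¹ :=
  fun e => hx (by nth_rw 2 [e]; simp)

/-- A symmetric set with at most three elements contains at most one pair `{s, s⁻¹}` of
non-involutions, since two such pairs make four elements. -/
lemma eq_or_eq_inv_of_card_le_three {G : Type*} [Group G] {S : Finset G}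
    (hS : ∀ s ∈ S, s⁻¹ ∈ S) (hcard : S.card ≤ 3) {s t : G} (hs : s ∈ S) (ht : t ∈ S)
    (hs2 : s * s ≠ 1) (ht2 : t * t ≠ 1) : t = s ∨ t = s⁻¹ := by
  classical
  by_contra! h
  have hsub : ({s, s⁻¹, t, t⁻¹} : Finset G) ⊆ S := by
    intro x hx
    simp only [Finset.mem_insert, Finset.mem_singleton] at hx
    rcases hx with rfl | rfl | rfl | rfl
    exacts [hs, hS _ hs, ht, hS _ ht]
  have h4 : ({s, s⁻¹, t, t⁻¹} : Finset G).card = 4 := by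
    have e1 : s ≠ s⁻¹ := ne_inv_of_mul_self_ne_one hs2
    have e2 : t ≠ t⁻¹ := ne_inv_of_mul_self_ne_one ht2
    have e3 : s ≠ t⁻¹ := fun e => h.2 (by rw [e, inv_inv])
    have e4 : s⁻¹ ≠ t⁻¹ := fun e => h.1 (inv_injective e).symm
    rw [Finset.card_insert_of_notMem, Finset.card_insert_of_notMem,
      Finset.card_insert_of_notMem] <;>
      simp [e1, e2, e3, e4, h.1.symm, inv_eq_iff_eq_inv]
  have := Finset.card_le_card hsub
  omega

/-- If every element has order dividing `4` or `6` and the involutions are central, the at most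
three translations making up the adjacency operator commute. On a common eigenvector, an
involution contributes `±1` and a pair `{s, s⁻¹}` contributes `c + c⁻¹` with `c` a root of unity
of order dividing `4` or `6`. -/
theorem isInClassG_three_of_pow_eq_one {G : Type*} [Group G] [Fintype G]
    (hexp : ∀ x : G, x ^ 4 = 1 ∨ x ^ 6 = 1)
    (hcent : ∀ x : G, x * x = 1 → x ∈ Subgroup.center G) : IsInClassG 3 G := by
  classical
  intro S hS h1 hcard
  rw [isIntegralGraph_cayleyGraph_iff hS h1]
  intro μ hμ
  have hcommG : ∀ s ∈ S, ∀ t ∈ S, Commute s t := by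
    intro s hs t ht
    by_cases hs2 : s * s = 1
    · exact ((Subgroup.mem_center_iff.1 (hcent s hs2)) t).symm
    by_cases ht2 : t * t = 1
    · exact (Subgroup.mem_center_iff.1 (hcent t ht2)) s
    rcases eq_or_eq_inv_of_card_le_three hS hcard hs ht hs2 ht2 with rfl | rfl
    · exact Commute.refl _
    · exact (Commute.refl s).inv_right
  have hcomm : ∀ s ∈ S, ∀ t ∈ S, Commute (translation G s) (translation G t) :=
    fun s hs t ht => (hcommG s hs t ht).map (translation G)
  obtain ⟨v, hv, hv0, hvS⟩ := exists_common_eigenvector (translation G) S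
    ((∑ s ∈ S, translation G s).eigenspace μ) hμ
    (fun s hs w hw => by
      have hsum : Commute (∑ t ∈ S, translation G t) (translation G s) :=
        Commute.sum_left _ _ _ fun t ht => hcomm t ht s hs
      have h := LinearMap.congr_fun hsum.eq w
      rw [Module.End.mem_eigenspace_iff] at hw ⊢
      simp only [Module.End.mul_apply] at h
      rw [h, hw, map_smul]) hcomm
  choose! c hc using hvS
  have hμc : μ = ∑ s ∈ S, c s := by
    have h := Module.End.mem_eigenspace_iff.1 hv
    rw [LinearMap.sum_apply, Finset.sum_congr rfl hc, ← Finset.sum_smul] at h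
    exact (smul_left_injective ℂ hv0 h).symm
  have hpow (s : G) (hs : s ∈ S) (n : ℕ) : translation G (s ^ n) v = c s ^ n • v := by
    induction n with
    | zero => simp
    | succ n ih => rw [pow_succ', ← translation_translation, ih, map_smul, hc s hs, smul_smul,
        pow_succ]
  have hpow1 (s : G) (hs : s ∈ S) (n : ℕ) (h : s ^ n = 1) : c s ^ n = 1 := by
    have := hpow s hs n
    rw [h, translation_one] at this
    exact smul_left_injective ℂ hv0 (by simpa using this.symm)
  have hinv (s : G) (hs : s ∈ S) : c s * c s⁻¹ = 1 := by
    have := translation_translation s s⁻¹ v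
    rw [mul_inv_cancel, translation_one, hc _ (hS s hs), map_smul, hc s hs, smul_smul] at this
    exact smul_left_injective ℂ hv0 (by simpa [mul_comm] using this)
  rw [hμc, ← Finset.sum_filter_add_sum_filter_not S (fun s => s * s = 1)]
  have hA : ∃ z : ℤ, ∑ s ∈ S with s * s = 1, c s = z := by
    have : ∀ s ∈ S.filter (fun s => s * s = 1), ∃ z : ℤ, c s = z := by
      intro s hs
      rw [Finset.mem_filter] at hs
      rcases mul_self_eq_one_iff.1 ((pow_two (c s)).symm.trans (hpow1 s hs.1 2 (by rw [pow_two, hs.2]))) with h | h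
      · exact ⟨1, by simp [h]⟩
      · exact ⟨-1, by simp [h]⟩
    choose! z hz using this
    exact ⟨∑ s ∈ S with s * s = 1, z s, by push_cast; exact Finset.sum_congr rfl hz⟩
  have hB : ∃ z : ℤ, ∑ s ∈ S with ¬ s * s = 1, c s = z := by
    rcases (S.filter (fun s => ¬ s * s = 1)).eq_empty_or_nonempty with h | ⟨x, hx⟩
    · exact ⟨0, by simp [h]⟩
    rw [Finset.mem_filter] at hx
    have hxx : x ≠ x⁻¹ := ne_inv_of_mul_self_ne_one hx.2
    have hpair : S.filter (fun s => ¬ s * s = 1) = {x, x⁻¹} := by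
      ext t
      simp only [Finset.mem_filter, Finset.mem_insert, Finset.mem_singleton]
      constructor
      · exact fun ht => eq_or_eq_inv_of_card_le_three hS hcard hx.1 ht.1 hx.2 ht.2
      · rintro (rfl | rfl)
        · exact hx
        · exact ⟨hS x hx.1, fun h => hx.2 (by simpa using congrArg (·⁻¹) h)⟩
    rw [hpair, Finset.sum_pair hxx]
    exact exists_int_eq_add_of_mul_eq_one (hinv x hx.1)
      ((hexp x).imp (hpow1 x hx.1 4) (hpow1 x hx.1 6))
  obtain ⟨a, ha⟩ := hA
  obtain ⟨b, hb⟩ := hB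
  exact ⟨a + b, by rw [ha, hb]; push_cast; rfl⟩

/-! ### Forbidden eigenvalues -/

section Forbidden

variable {G : Type*} [Group G]

/-- A nonzero vector with `T (T v) = c • v` is a sum of eigenvectors for the square roots
of `c`. -/
lemma exists_int_sq_of_apply_apply {V : Type*} [AddCommGroup V] [Module ℂ V]
    {T : Module.End ℂ V} (hT : ∀ μ : ℂ, T.HasEigenvalue μ → ∃ z : ℤ, μ = z) {v : V}
    (hv : v ≠ 0) {c : ℂ} (hc : T (T v) = c • v) : ∃ z : ℤ, c = z ^ 2 := by
  obtain ⟨r, hr⟩ := IsAlgClosed.exists_eq_mul_self c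
  have key (r : ℂ) (hr : c = r * r) (w : V) (hw : w ≠ 0) (h : T w = r • w) :
      ∃ z : ℤ, c = z ^ 2 := by
    obtain ⟨z, hz⟩ := hT r (Module.End.hasEigenvalue_of_hasEigenvector
      (Module.End.hasEigenvector_iff.2 ⟨Module.End.mem_eigenspace_iff.2 h, hw⟩))
    exact ⟨z, by rw [hr, hz, sq]⟩
  by_cases hu : T v + r • v = 0
  · exact key (-r) (by rw [hr]; ring) v hv (by rw [neg_smul]; exact eq_neg_of_add_eq_zero_left hu)
  · refine key r hr _ hu ?_
    rw [map_add, map_smul, hc, hr, smul_add, smul_smul, add_comm]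

lemma Nat.Prime.ne_int_sq {p : ℕ} (hp : p.Prime) : ¬ ∃ z : ℤ, (p : ℂ) = z ^ 2 := by
  rintro ⟨z, hz⟩
  have hz' : (p : ℤ) = z ^ 2 := by exact_mod_cast hz
  exact hp.prime.not_isSquare ⟨z.natAbs, by zify; rw [hz', sq, abs_mul_abs_self]⟩

/-- If `x` has order `n`, the adjacency operator of `Cay(G, {x, x⁻¹})` has the eigenvalue
`2 cos (2π / n)`, which by Niven's theorem is an integer only for `n ∈ {1, 2, 3, 4, 6}`. -/
theorem IsInClassG.pow_four_eq_one_or_pow_six_eq_one [Fintype G] (h : IsInClassG 3 G) (x : G) :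
    x ^ 4 = 1 ∨ x ^ 6 = 1 := by
  classical
  by_contra! hx
  have hxx : x * x ≠ 1 := fun e => hx.1 (by rw [show 4 = 2 * 2 from rfl, pow_mul, sq x, e, one_pow])
  have hS : ∀ s ∈ ({x, x⁻¹} : Finset G), s⁻¹ ∈ ({x, x⁻¹} : Finset G) := by simp
  have h1 : (1 : G) ∉ ({x, x⁻¹} : Finset G) := by
    have : x ≠ 1 := fun e => hxx (by simp [e])
    simp [this, this.symm]
  have hint := (isIntegralGraph_cayleyGraph_iff hS h1).1
    (h _ hS h1 ((Finset.card_le_two).trans (by norm_num)))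
  rw [Finset.sum_pair (ne_inv_of_mul_self_ne_one hxx)] at hint
  set n := orderOf x with hn
  have hn0 : 0 < n := orderOf_pos x
  have hn4 : ¬ n ∣ 4 := fun d => hx.1 (orderOf_dvd_iff_pow_eq_one.1 d)
  have hn6 : ¬ n ∣ 6 := fun d => hx.2 (orderOf_dvd_iff_pow_eq_one.1 d)
  set ζ := Complex.exp (2 * Real.pi * Complex.I / n) with hζ
  have hζn : ζ ^ n = 1 := (Complex.isPrimitiveRoot_exp n hn0.ne').pow_eq_one
  have hζ0 : ζ ≠ 0 := Complex.exp_ne_zero _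
  -- `w` is the projection of the point mass at `1` to the `ζ`-eigenspace of translation by `x`.
  set T := translation G x with hTdef
  set w : G → ℂ := (∑ i ∈ Finset.range n, T ^ i * (algebraMap ℂ (Module.End ℂ (G → ℂ)) ζ) ^
    (n - 1 - i)) (Pi.single 1 1) with hw
  have hTw : T w = ζ • w := by
    have hc : Commute T (algebraMap ℂ (Module.End ℂ (G → ℂ)) ζ) :=
      Algebra.commute_algebraMap_right ζ T
    have e := LinearMap.congr_fun (hc.mul_geom_sum₂ n) (Pi.single 1 1)
    rw [← map_pow, ← map_pow, hζn, pow_orderOf_eq_one, map_one, map_one, sub_self,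
      Module.End.mul_apply, LinearMap.sub_apply, ← hw, LinearMap.zero_apply, sub_eq_zero] at e
    exact e
  have hw1 : w 1 = ζ ^ (n - 1) := by
    rw [hw, LinearMap.sum_apply, Finset.sum_apply, Finset.sum_eq_single 0]
    · rw [pow_zero, one_mul, ← map_pow, Module.algebraMap_end_apply]
      simp
    · intro i hi hi0
      rw [Module.End.mul_apply, ← map_pow (algebraMap _ _), Module.algebraMap_end_apply, map_smul,
        hTdef, ← map_pow, translation_single, mul_one, Pi.smul_apply, Pi.single_eq_of_ne, smul_zero]
      exact fun e => pow_ne_one_of_lt_orderOf hi0 (Finset.mem_range.1 hi) e.symm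
    · intro h0
      exact absurd (Finset.mem_range.2 hn0) h0
  have hw0 : w ≠ 0 := fun e => pow_ne_zero (n - 1) hζ0 (by rw [← hw1, e]; rfl)
  have hTw' : translation G x⁻¹ w = ζ⁻¹ • w := by
    have := translation_translation x⁻¹ x w
    rw [inv_mul_cancel, translation_one, ← hTdef, hTw, map_smul] at this
    rw [← this, smul_smul, inv_mul_cancel₀ hζ0, one_smul, this]
  obtain ⟨z, hz⟩ := hint (ζ + ζ⁻¹) (Module.End.hasEigenvalue_of_hasEigenvector
    (Module.End.hasEigenvector_iff.2 ⟨Module.End.mem_eigenspace_iff.2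
      (by rw [LinearMap.add_apply, hTw, hTw', add_smul]), hw0⟩))
  have hcos : Real.cos (((2 / n : ℚ) : ℝ) * Real.pi) = z / 2 := by
    have e : ζ + ζ⁻¹ = 2 * Complex.cos (2 * Real.pi / n) := by
      rw [Complex.two_cos, hζ, ← Complex.exp_neg]
      congr 2 <;> ring
    have e2 : (2 * Real.cos (((2 / n : ℚ) : ℝ) * Real.pi) : ℂ) = z := by
      rw [← hz, e]
      push_cast
      congr 2
      ring
    have e3 : 2 * Real.cos (((2 / n : ℚ) : ℝ) * Real.pi) = z := by exact_mod_cast e2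
    linarith
  have hden : (2 / n : ℚ).den ≤ 3 := by
    by_contra! hlt
    exact irrational_cos_rat_mul_pi hlt ⟨z / 2, by rw [hcos]; push_cast; rfl⟩
  have hdvd : (n : ℤ) ∣ 2 * (2 / n : ℚ).den := by
    refine ⟨(2 / n : ℚ).num, ?_⟩
    have h1 := Rat.num_div_den (2 / n : ℚ)
    have hd : ((2 / n : ℚ).den : ℚ) ≠ 0 := by exact_mod_cast (2 / n : ℚ).den_nz
    have hnq : (n : ℚ) ≠ 0 := by exact_mod_cast hn0.ne'
    generalize (2 / n : ℚ).num = p at *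
    generalize hdd : (2 / n : ℚ).den = d at *
    field_simp at h1
    have : (2 * d : ℚ) = n * p := by linarith
    exact_mod_cast this
  have hdvd' : n ∣ 2 * (2 / n : ℚ).den := by exact_mod_cast hdvd
  have hpos := (2 / n : ℚ).den_pos
  generalize (2 / n : ℚ).den = d at *
  interval_cases d
  · exact hn4 (hdvd'.trans (by norm_num))
  · exact hn4 hdvd'
  · exact hn6 hdvd'

/-- If the involutions `a` and `b` do not commute and `(a * b) ^ 4 = 1`, they generate a dihedral
group of order `8`, and `Cay(G, {a, b})` is a union of `8`-cycles, with eigenvalue `√2`. -/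
theorem IsInClassG.commute_of_involutions [Fintype G] (h : IsInClassG 3 G) {a b : G}
    (ha : a * a = 1) (hb : b * b = 1) (hab : (a * b) ^ 4 = 1) : Commute a b := by
  classical
  by_contra hcomm
  have ha1 : a ≠ 1 := fun e => hcomm (by rw [e]; exact Commute.one_left b)
  have hb1 : b ≠ 1 := fun e => hcomm (by rw [e]; exact Commute.one_right a)
  have hne : a ≠ b := fun e => hcomm (by rw [e])
  have hai : a⁻¹ = a := inv_eq_of_mul_eq_one_left ha
  have hbi : b⁻¹ = b := inv_eq_of_mul_eq_one_left hb
  have hS : ∀ s ∈ ({a, b} : Finset G), s⁻¹ ∈ ({a, b} : Finset G) := by simp [hai, hbi]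
  have h1 : (1 : G) ∉ ({a, b} : Finset G) := by simp [ha1.symm, hb1.symm]
  have hint := (isIntegralGraph_cayleyGraph_iff hS h1).1
    (h _ hS h1 ((Finset.card_le_two).trans (by norm_num)))
  rw [Finset.sum_pair hne] at hint
  have hba : (a * b)⁻¹ = b * a := by rw [mul_inv_rev, hai, hbi]
  set y := a * b with hy
  have hz : y * y ≠ 1 := fun e => hcomm (by
    have : y = y⁻¹ := eq_inv_of_mul_eq_one_left e
    rw [hba] at this
    exact this)
  have hy4 : y * (y * (y * y)) = 1 := by rw [← hab]; simp [pow_succ, mul_assoc]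
  -- The operator `a b + b a` kills `v`, because `(a b)² v = -v`.
  set v : G → ℂ := Pi.single 1 1 - Pi.single (y * y) 1 with hv
  have hv0 : v ≠ 0 := by
    intro e
    have := congrFun e 1
    simp [hv, Pi.single_eq_of_ne hz.symm] at this
  have e1 : y * (y * y) = y⁻¹ := eq_inv_of_mul_eq_one_right hy4
  refine Nat.prime_two.ne_int_sq
    (exists_int_sq_of_apply_apply hint hv0 (c := (2 : ℕ)) ?_)
  have e2 : translation G y v + translation G y⁻¹ v = 0 := by
    rw [hv, map_sub, map_sub, translation_single, translation_single, translation_single,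
      translation_single, e1, inv_mul_cancel_left, mul_one, mul_one]
    abel
  simp only [LinearMap.add_apply, map_add, translation_translation, ha, hb, ← hy, ← hba,
    translation_one]
  rw [eq_neg_of_add_eq_zero_left e2]
  push_cast
  rw [two_smul]
  abel

/-- Suppose that all elements of `G` have order dividing `4`, so that the involutions of `G`
commute with each other. If an involution `a` is distinct from its conjugate `b` by `x`, then
`x`, `x⁻¹` and `a` have a representation of degree two with `x ^ 2 = 1` and `a * b = -1`,
in which `x + x⁻¹ + a` squares to `5`. -/
theorem IsInClassG.involution_mem_center [Fintype G] (h : IsInClassG 3 G)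
    (h4 : ∀ x : G, x ^ 4 = 1) {a : G} (ha : a * a = 1) : a ∈ Subgroup.center G := by
  classical
  have hinv {c d : G} (hc : c * c = 1) (hd : d * d = 1) : c * d = d * c :=
    (h.commute_of_involutions hc hd (h4 _)).eq
  rw [Subgroup.mem_center_iff]
  intro x
  by_contra hxa
  have hx4 : (x * x) * (x * x) = 1 := by rw [← h4 x]; simp [pow_succ, mul_assoc]
  have hxx : x * x ≠ 1 := fun e => hxa (hinv e ha)
  obtain ⟨b, hb⟩ : ∃ b, b = x⁻¹ * a * x := ⟨_, rfl⟩
  have haxb : a * x = x * b := by rw [hb]; group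
  have hbb : b * b = 1 := by
    rw [hb, show x⁻¹ * a * x * (x⁻¹ * a * x) = x⁻¹ * (a * a) * x by group, ha]; group
  have hab : a * b = b * a := hinv ha hbb
  have hax : a * (x * x) = (x * x) * a := hinv ha hx4
  have hai : a⁻¹ = a := inv_eq_of_mul_eq_one_left ha
  have hxi : x⁻¹ * x⁻¹ = x * x := by
    rw [← mul_inv_rev]; exact inv_eq_of_mul_eq_one_left hx4
  have hne : a * b ≠ 1 := fun e => hxa (by
    have : b = a := by rw [← hai]; exact eq_inv_of_mul_eq_one_right e
    rw [haxb, this])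
  -- If `x ^ 2 = a * b`, then `a` and `x` generate a dihedral group of order `8`, in which
  -- the involutions `a` and `a * x` do not commute.
  have hne2 : x * x * (a * b) ≠ 1 := by
    intro e
    have e1 : x * x = a * b := by
      rw [eq_inv_of_mul_eq_one_left e, mul_inv_rev, hai, inv_eq_of_mul_eq_one_left hbb, hab]
    have e2 : (a * x) * (a * x) = 1 := by
      nth_rw 2 [haxb]
      rw [show a * x * (x * b) = a * (x * x) * b by group, e1, ← mul_assoc, ha, one_mul, hbb]
    have e3 := hinv ha e2
    rw [← mul_assoc, ha, one_mul] at e3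
    exact hxa (by nth_rw 1 [e3]; rw [mul_assoc, mul_assoc, ha, mul_one])
  have ha1 : a ≠ 1 := fun e => hxa (by simp [e])
  have hx1 : x ≠ 1 := fun e => hxa (by simp [e])
  have hax1 : a ≠ x := fun e => hxx (by rw [← e, ha])
  have hax2 : a ≠ x⁻¹ := fun e => hax1 (by rw [← hai, e, inv_inv])
  have hS : ∀ s ∈ ({a, x, x⁻¹} : Finset G), s⁻¹ ∈ ({a, x, x⁻¹} : Finset G) := by simp [hai]
  have h1 : (1 : G) ∉ ({a, x, x⁻¹} : Finset G) := by simp [ha1.symm, hx1, hx1.symm]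
  have hint := (isIntegralGraph_cayleyGraph_iff hS h1).1 (h _ hS h1 Finset.card_le_three)
  rw [Finset.sum_insert (by simp [hax1, hax2]),
    Finset.sum_pair (ne_inv_of_mul_self_ne_one hxx)] at hint
  -- `v` is the point mass at `1` multiplied by `(1 + x ^ 2) * (1 - a * b)`.
  set v : G → ℂ := Pi.single 1 1 + Pi.single (x * x) 1 - Pi.single (a * b) 1 -
    Pi.single (x * x * (a * b)) 1 with hv
  have hv0 : v ≠ 0 := by
    intro e
    have := congrFun e 1
    simp [hv, Pi.single_eq_of_ne hxx.symm, Pi.single_eq_of_ne hne.symm,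
      Pi.single_eq_of_ne hne2.symm] at this
  have hvx : translation G (x * x) v = v := by
    simp only [hv, map_sub, map_add, translation_single, mul_one, hx4]
    rw [← mul_assoc (x * x) (x * x), hx4, one_mul]
    abel
  have habab : a * b * (a * b) = 1 := by
    nth_rw 2 [hab]
    rw [mul_assoc, ← mul_assoc b b, hbb, one_mul, ha]
  have hvab : translation G (a * b) v = -v := by
    have e : a * b * (x * x) = x * x * (a * b) := hinv habab hx4
    have e' : a * b * (x * x * (a * b)) = x * x := by
      rw [← mul_assoc, e, mul_assoc, habab, mul_one]
    simp only [hv, map_sub, map_add, translation_single, mul_one, habab, e, e']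
    abel
  have e1 : translation G (a * x) v = -translation G (x * a) v := by
    rw [haxb, show x * b = x * a * (a * b) by
      rw [mul_assoc x a, ← mul_assoc a a, ha, one_mul], ← translation_translation, hvab, map_neg]
  have e2 : translation G (a * x⁻¹) v = -translation G (x⁻¹ * a) v := by
    have : a * x⁻¹ = x⁻¹ * a * (a * b) := by
      rw [mul_assoc x⁻¹ a, ← mul_assoc a a, ha, one_mul, hb,
        show x⁻¹ * (x⁻¹ * a * x) = x⁻¹ * x⁻¹ * a * x by group, hxi, ← hax,
        show a * (x * x) * x = a * x⁻¹ * ((x * x) * (x * x)) by group, hx4, mul_one]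
    rw [this, ← translation_translation, hvab, map_neg]
  refine Nat.prime_five.ne_int_sq
    (exists_int_sq_of_apply_apply hint hv0 (c := (5 : ℕ)) ?_)
  simp only [LinearMap.add_apply, map_add, translation_translation, ha, hxi, mul_inv_cancel,
    inv_mul_cancel, translation_one, hvx, e1, e2]
  rw [Nat.cast_smul_eq_nsmul]
  abel

end Forbidden

/-! ### Nilpotent groups -/

/-- A finite group in which all squares are trivial is a vector space over `ZMod 2`. -/
lemma exists_mulEquiv_elemAbTwo {H : Type*} [Group H] [Finite H] (h : ∀ x : H, x * x = 1) :
    ∃ n : ℕ, Nonempty (H ≃* ElemAbTwo n) := by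
  let _ : CommGroup H :=
    { ‹Group H› with
      mul_comm := fun a b => (Commute.of_orderOf_dvd_two
        (fun g => orderOf_dvd_of_pow_eq_one (by rw [pow_two, h])) a b).eq }
  let _ : Module (ZMod 2) (Additive H) :=
    AddCommGroup.zmodModule (fun x => by rw [two_nsmul]; exact h x.toMul)
  let e := (Module.finBasis (ZMod 2) (Additive H)).equivFun
  refine ⟨_, ⟨{
    toFun := fun x i => Multiplicative.ofAdd (e (Additive.ofMul x) i)
    invFun := fun f => (e.symm fun i => (f i).toAdd).toMul
    left_inv := fun x => by simp
    right_inv := fun f => by simp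
    map_mul' := fun x y => by
      funext i
      simp [ofMul_mul] }⟩⟩

lemma elemAbTwo_mul_self {n : ℕ} (x : ElemAbTwo n) : x * x = 1 := by
  funext i
  exact congrArg Multiplicative.ofAdd (CharTwo.add_self_eq_zero (x i).toAdd)

lemma isThreeGroupOfExponentThree_iff {B : Type*} [Group B] :
    IsThreeGroupOfExponentThree B ↔ Nontrivial B ∧ ∀ x : B, x ^ 3 = 1 := by
  constructor
  · rintro ⟨-, h⟩
    refine ⟨?_, fun x => h ▸ Monoid.pow_exponent_eq_one x⟩
    by_contra hB
    rw [not_nontrivial_iff_subsingleton] at hB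
    rw [Monoid.exp_eq_one_of_subsingleton] at h
    omega
  · rintro ⟨hB, h⟩
    refine ⟨fun x => ⟨1, by simpa using h x⟩, ?_⟩
    refine ((Nat.dvd_prime Nat.prime_three).1
      (Monoid.exponent_dvd_of_forall_pow_eq_one h)).resolve_left fun h1 => ?_
    exact not_subsingleton B (Monoid.exp_eq_one_iff.1 h1)

lemma mem_sylow_of_pow_eq_one {G : Type*} [Group G] [Finite G] {p : ℕ} [Fact p.Prime]
    (P : Sylow p G) (hP : (P : Subgroup G).Normal) {x : G} {k : ℕ} (hx : x ^ p ^ k = 1) :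
    x ∈ (P : Subgroup G) := by
  have hz : IsPGroup p (Subgroup.zpowers x) := by
    rintro ⟨_, m, rfl⟩
    refine ⟨k, Subtype.ext ?_⟩
    change (x ^ m) ^ p ^ k = 1
    rw [← zpow_natCast, zpow_comm, zpow_natCast, hx, one_zpow]
  obtain ⟨Q, hQ⟩ := hz.exists_le_sylow
  have := P.unique_of_normal hP
  rw [Subsingleton.elim P Q]
  exact hQ (Subgroup.mem_zpowers x)

/-- A nilpotent group with exponent dividing `6` is the product of its Sylow subgroups for
`2` and `3`: every `x` is `x ^ 3 * (x ^ 2)⁻¹`. -/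
lemma exists_mulEquiv_elemAbTwo_prod {G : Type u} [Group G] [Finite G]
    (hG : Group.IsNilpotent G) (h6 : ∀ x : G, x ^ 6 = 1) :
    ∃ (n : ℕ) (B : Type u) (_ : Group B), (∀ x : B, x ^ 3 = 1) ∧
      Nonempty (G ≃* ElemAbTwo n × B) := by
  have hnorm := (Group.isNilpotent_of_finite_tfae (G := G)).out 0 3 |>.1 hG
  have hf2 : Fact (Nat.Prime 2) := ⟨Nat.prime_two⟩
  have hf3 : Fact (Nat.Prime 3) := ⟨Nat.prime_three⟩
  let P : Sylow 2 G := default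
  let Q : Sylow 3 G := default
  have hP := hnorm 2 hf2 P
  have hQ := hnorm 3 hf3 Q
  have hdisj : Disjoint (P : Subgroup G) (Q : Subgroup G) :=
    IsPGroup.disjoint_of_ne 2 3 (by norm_num) _ _ P.isPGroup' Q.isPGroup'
  have hcomm (x : P) (y : Q) :
      Commute ((P : Subgroup G).subtype x) ((Q : Subgroup G).subtype y) :=
    Subgroup.commute_of_normal_of_disjoint _ _ hP hQ hdisj _ _ x.2 y.2
  have hP2 (x : P) : x * x = 1 := by
    obtain ⟨k, hk⟩ := P.isPGroup' x
    have hx6 : x ^ 6 = 1 := Subtype.ext (h6 x)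
    have hd := Nat.dvd_gcd (orderOf_dvd_of_pow_eq_one hk) (orderOf_dvd_of_pow_eq_one hx6)
    have h2 : Nat.gcd (2 ^ k) 6 ∣ 2 := by
      have : Nat.Coprime (Nat.gcd (2 ^ k) 6) 3 :=
        Nat.Coprime.coprime_dvd_left (Nat.gcd_dvd_left _ _)
          (Nat.Coprime.pow_left k (by norm_num))
      exact this.dvd_of_dvd_mul_right (k := Nat.gcd (2 ^ k) 6) (m := 2) (Nat.gcd_dvd_right _ 6)
    rw [← pow_two]
    exact orderOf_dvd_iff_pow_eq_one.1 (hd.trans h2)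
  have hQ3 (x : Q) : x ^ 3 = 1 := by
    obtain ⟨k, hk⟩ := Q.isPGroup' x
    have hx6 : x ^ 6 = 1 := Subtype.ext (h6 x)
    have hd := Nat.dvd_gcd (orderOf_dvd_of_pow_eq_one hk) (orderOf_dvd_of_pow_eq_one hx6)
    have h3 : Nat.gcd (3 ^ k) 6 ∣ 3 := by
      have : Nat.Coprime (Nat.gcd (3 ^ k) 6) 2 :=
        Nat.Coprime.coprime_dvd_left (Nat.gcd_dvd_left _ _)
          (Nat.Coprime.pow_left k (by norm_num))
      exact this.dvd_of_dvd_mul_right (k := Nat.gcd (3 ^ k) 6) (m := 3) (Nat.gcd_dvd_right _ 6)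
    exact orderOf_dvd_iff_pow_eq_one.1 (hd.trans h3)
  obtain ⟨n, ⟨e⟩⟩ := exists_mulEquiv_elemAbTwo hP2
  let f : P × Q →* G := MonoidHom.noncommCoprod _ _ hcomm
  have hf : Function.Bijective f := by
    constructor
    · rw [MonoidHom.noncommCoprod_injective]
      exact ⟨Subtype.val_injective, Subtype.val_injective, by simpa using hdisj⟩
    · intro x
      have h2 : x ^ 3 ∈ (P : Subgroup G) :=
        mem_sylow_of_pow_eq_one P hP (k := 1) (by rw [← pow_mul]; exact h6 x)
      have h3 : x ^ 2 ∈ (Q : Subgroup G) :=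
        mem_sylow_of_pow_eq_one Q hQ (k := 1) (by rw [← pow_mul]; exact h6 x)
      exact ⟨(⟨_, h2⟩, ⟨_, inv_mem h3⟩), by
        change x ^ 3 * (x ^ 2)⁻¹ = x
        group⟩
  exact ⟨n, Q, inferInstance, hQ3,
    ⟨(MulEquiv.ofBijective f hf).symm.trans (e.prodCongr (MulEquiv.refl Q))⟩⟩

/-- An element of order `4` would give, together with a commuting element of order `3`, an
element of order `12`. -/
lemma pow_six_eq_one_of_pow_three_eq_one {G : Type*} [Group G] [Finite G]
    (hG : Group.IsNilpotent G) (h46 : ∀ x : G, x ^ 4 = 1 ∨ x ^ 6 = 1) {y : G} (hy : y ≠ 1)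
    (hy3 : y ^ 3 = 1) (x : G) : x ^ 6 = 1 := by
  refine (h46 x).elim (fun hx4 => ?_) id
  have hnorm := (Group.isNilpotent_of_finite_tfae (G := G)).out 0 3 |>.1 hG
  have hf2 : Fact (Nat.Prime 2) := ⟨Nat.prime_two⟩
  have hf3 : Fact (Nat.Prime 3) := ⟨Nat.prime_three⟩
  let P : Sylow 2 G := default
  let Q : Sylow 3 G := default
  have hP := hnorm 2 hf2 P
  have hQ := hnorm 3 hf3 Q
  have hxy : Commute x y := Subgroup.commute_of_normal_of_disjoint _ _ hP hQ
    (IsPGroup.disjoint_of_ne 2 3 (by norm_num) _ _ P.isPGroup' Q.isPGroup') _ _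
    (mem_sylow_of_pow_eq_one P hP (k := 2) hx4)
    (mem_sylow_of_pow_eq_one Q hQ (k := 1) (by simpa using hy3))
  rcases h46 (x * y) with h | h
  · rw [hxy.mul_pow, hx4, one_mul, pow_succ, hy3, one_mul] at h
    exact absurd h hy
  · rwa [hxy.mul_pow, show 6 = 3 * 2 from rfl, pow_mul y, hy3, one_pow, mul_one] at h

theorem corollary2p8 {G : Type u} [Group G] [Fintype G] (hG : Group.IsNilpotent G) :
    IsInClassG 3 G ↔
      IsThreeGroupOfExponentThree G ∨
      (∃ n : ℕ, Nonempty (G ≃* ElemAbTwo n)) ∨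
      (IsPGroup 2 G ∧ Monoid.exponent G = 4 ∧
        ∀ x : G, orderOf x = 2 → x ∈ Subgroup.center G) ∨
      (∃ n : ℕ, 1 ≤ n ∧ ∃ (B : Type u) (_ : Group B), IsThreeGroupOfExponentThree B ∧
        Nonempty (G ≃* ElemAbTwo n × B)) := by
  constructor
  · intro h
    have h46 := h.pow_four_eq_one_or_pow_six_eq_one
    by_cases hy : ∃ y : G, y ≠ 1 ∧ y ^ 3 = 1
    · obtain ⟨y, hy1, hy3⟩ := hy
      obtain ⟨n, B, _, hB, ⟨e⟩⟩ := exists_mulEquiv_elemAbTwo_prod hG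
        (pow_six_eq_one_of_pow_three_eq_one hG h46 hy1 hy3)
      rcases Nat.eq_zero_or_pos n with rfl | hn
      · -- `ElemAbTwo 0` is trivial, so `G` is isomorphic to `B`.
        refine Or.inl (isThreeGroupOfExponentThree_iff.2 ⟨⟨y, 1, hy1⟩, fun x => e.injective ?_⟩)
        rw [map_pow, map_one]
        exact Prod.ext (Subsingleton.elim _ _) (hB _)
      · refine Or.inr (Or.inr (Or.inr ⟨n, hn, B, _, isThreeGroupOfExponentThree_iff.2
          ⟨⟨(e y).2, 1, fun hy2 => hy1 (e.injective ?_)⟩, hB⟩, ⟨e⟩⟩))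
        -- The component of `y` in `ElemAbTwo n` is killed by both `2` and `3`.
        have h1 : (e y).1 ^ 3 = 1 := by rw [← Prod.pow_fst, ← map_pow, hy3, map_one]; rfl
        rw [pow_succ, pow_two, elemAbTwo_mul_self, one_mul] at h1
        rw [map_one]
        exact Prod.ext h1 hy2
    · push Not at hy
      have h4 (x : G) : x ^ 4 = 1 := by
        refine (h46 x).elim id fun hx => ?_
        have hx2 : x ^ 2 = 1 := by
          by_contra hne
          exact hy _ hne (by rw [← pow_mul]; exact hx)
        rw [show 4 = 2 * 2 from rfl, pow_mul, hx2, one_pow]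
      by_cases h2 : ∀ x : G, x * x = 1
      · exact Or.inr (Or.inl (exists_mulEquiv_elemAbTwo h2))
      · refine Or.inr (Or.inr (Or.inl ⟨fun x => ⟨2, h4 x⟩, ?_, fun x hx =>
          h.involution_mem_center h4 (by rw [← pow_two, ← hx, pow_orderOf_eq_one])⟩))
        obtain ⟨i, hi, hexp⟩ := (Nat.dvd_prime_pow Nat.prime_two (m := 2)).1
          (Monoid.exponent_dvd_of_forall_pow_eq_one h4)
        rcases Nat.lt_or_ge i 2 with hi2 | hi2
        · refine absurd (fun x => ?_) h2
          rw [← pow_two]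
          refine orderOf_dvd_iff_pow_eq_one.1 ((Monoid.order_dvd_exponent x).trans ?_)
          rw [hexp]
          exact pow_dvd_pow 2 (Nat.lt_succ_iff.1 hi2)
        · rw [hexp, le_antisymm hi hi2]
          norm_num
  · rintro (h | ⟨n, ⟨e⟩⟩ | ⟨-, hexp, hc⟩ | ⟨n, -, B, _, hB, ⟨e⟩⟩)
    · have h3 := (isThreeGroupOfExponentThree_iff.1 h).2
      refine isInClassG_three_of_pow_eq_one
        (fun x => Or.inr (by rw [show 6 = 3 * 2 from rfl, pow_mul, h3, one_pow])) fun x hx => ?_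
      have := h3 x
      rw [pow_succ, pow_two, hx, one_mul] at this
      rw [this]
      exact one_mem _
    · have h2 (x : G) : x * x = 1 := e.injective (by rw [map_mul, map_one, elemAbTwo_mul_self])
      refine isInClassG_three_of_pow_eq_one
        (fun x => Or.inl (by rw [show 4 = 2 * 2 from rfl, pow_mul, pow_two x, h2, one_pow]))
        fun x _ => Subgroup.mem_center_iff.2 fun y => e.injective ?_
      rw [map_mul, map_mul, mul_comm]
    · refine isInClassG_three_of_pow_eq_one
        (fun x => Or.inl (hexp ▸ Monoid.pow_exponent_eq_one x)) fun x hx => ?_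
      by_cases hx1 : x = 1
      · rw [hx1]
        exact one_mem _
      · exact hc x (orderOf_eq_prime (by rw [pow_two, hx]) hx1)
    · have h3 := (isThreeGroupOfExponentThree_iff.1 hB).2
      refine isInClassG_three_of_pow_eq_one (fun x => Or.inr (e.injective ?_)) fun x hx =>
        Subgroup.mem_center_iff.2 fun y => e.injective ?_
      · rw [map_pow, map_one]
        refine Prod.ext ?_ ?_
        · rw [Prod.pow_fst, show 6 = 2 * 3 from rfl, pow_mul, pow_two, elemAbTwo_mul_self,
            one_pow, Prod.fst_one]
        · rw [Prod.pow_snd, show 6 = 3 * 2 from rfl, pow_mul, h3, one_pow, Prod.snd_one]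
      · -- An involution has trivial component in `B`.
        have hx2 : (e x).2 = 1 := by
          have h1 := h3 (e x).2
          rwa [pow_succ, pow_two, ← Prod.snd_mul, ← map_mul, hx, map_one, Prod.snd_one,
            one_mul] at h1
        rw [map_mul, map_mul]
        refine Prod.ext (mul_comm _ _) ?_
        rw [Prod.snd_mul, Prod.snd_mul, hx2, one_mul, mul_one]
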